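/- Let $(\Omega,\mathcal F,P)$ be a probability space, $K=\mathbb R$ or $\mathbb C$, and let $L^0(\mathcal F,K)$ be the algebra of equivalence classes of $K$-valued random variables on $\Omega$. A random normed module over $K$ with base $(\Omega,\mathcal F,P)$ is a left module $S$ over the $K$-algebra $L^0(\mathcal F,K)$ with a map $\|\cdot\|:S\to L^0(\mathcal F,\mathbb R)$ such that, for all $x,y\in S$, $\alpha\in K$ and $\xi\in L^0(\mathcal F,K)$: $\|x\|\ge 0$, $\|\alpha x\|=|\alpha|\,\|x\|$, $\|x+y\|\le\|x\|+\|y\|$, $\|x\|=0$ implies $x=0$, and $\|\xi x\|=|\xi|\,\|x\|$. It is complete if it is complete in its $(\epsilon,\lambda)$-topology, i.e. the linear topology with the local base at $0$ formed by the sets $\{x\in S: P\{\|x\|<\epsilon\}>1-\lambda\}$, $\epsilon>0$, $0<\lambda<1$. Let $S(1)=\{x\in S:\|x\|=I_A \text{ for some } A\in\mathcal F \text{ with } P(A)>0\}$ and, for $x,y\in S$, let $B_{xy}=[\|x\|>0]\cap[\|y\|>0]\cap[\|x-y\|>0]$. A complete $S$ is random uniformly convex if for every number $\epsilon\in(0,2]$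 there is a number $\delta\in(0,1)$ such that, for all $x,y\in S(1)$ and all $D\in\mathcal F$ with $P(D)>0$ and $D\subseteq B_{xy}$ (up to a null set), $\|x-y\|\ge\epsilon$ a.s. on $D$ implies $\|x+y\|\le 2(1-\delta)$ a.s. on $D$. For $1<p<\infty$ let $L^p(S)=\{x\in S:\int_\Omega\|x\|^p\,dP<\infty\}$ with the norm $\|x\|_p=\big(\int_\Omega\|x\|^p\,dP\big)^{1/p}$. **Theorem 1.3.** Let $S$ be a complete random normed module and let $1<p<\infty$. Then $(L^p(S),\|\cdot\|_p)$ is a Banach space, and $S$ is random uniformly convex if and only if $L^p(S)$ is uniformly convex. -/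

import Mathlib

open MeasureTheory
open scoped ENNReal

/-! ### The algebra `L⁰(ℱ, 𝕜)` of equivalence classes of random variables -/

section L0

variable {Ω : Type*} [MeasurableSpace Ω] {P : Measure Ω} {𝕜 : Type*} [RCLike 𝕜]

/-- Pointwise (a.e.) addition and multiplication make `Ω →ₘ[P] 𝕜` a commutative ring.  The additive
and multiplicative structures are those of Mathlib. -/
noncomputable instance L0.instCommRing : CommRing (Ω →ₘ[P] 𝕜) :=
  { (inferInstance : AddCommGroup (Ω →ₘ[P] 𝕜)), (inferInstance : CommMonoid (Ω →ₘ[P] 𝕜)) with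
    left_distrib := fun a b c =>
      AEEqFun.induction_on₃ a b c fun f hf g hg h hh => by
        simp only [AEEqFun.mk_add_mk, AEEqFun.mk_mul_mk, mul_add]
    right_distrib := fun a b c =>
      AEEqFun.induction_on₃ a b c fun f hf g hg h hh => by
        simp only [AEEqFun.mk_add_mk, AEEqFun.mk_mul_mk, add_mul]
    zero_mul := fun a => AEEqFun.induction_on a fun f hf => by
        rw [AEEqFun.zero_def, AEEqFun.mk_mul_mk]
        exact AEEqFun.mk_eq_mk.2 (Filter.Eventually.of_forall fun ω => by simp)
    mul_zero := fun a => AEEqFun.induction_on a fun f hf => by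
        rw [AEEqFun.zero_def, AEEqFun.mk_mul_mk]
        exact AEEqFun.mk_eq_mk.2 (Filter.Eventually.of_forall fun ω => by simp) }

/-- The absolute value `|ξ| ∈ L⁰(ℱ, ℝ)` of `ξ ∈ L⁰(ℱ, 𝕜)`: the class of `ω ↦ |ξ(ω)|`. -/
noncomputable def L0.abs (ξ : Ω →ₘ[P] 𝕜) : Ω →ₘ[P] ℝ :=
  AEEqFun.comp (fun z : 𝕜 => ‖z‖) continuous_norm ξ

end L0

/-! ### Random normed modules -/

/-- An `L⁰`-norm on the left module `S` over the `𝕜`-algebra `L⁰(ℱ, 𝕜) = (Ω →ₘ[P] 𝕜)`.  The pair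
of `S` and such a norm is a random normed module over `𝕜` with base `(Ω, ℱ, P)`.  The inequalities
are those of `L⁰(ℱ, ℝ)`, that is, they hold almost surely. -/
structure RandomNorm {Ω : Type*} [MeasurableSpace Ω] (P : Measure Ω) (𝕜 : Type*) [RCLike 𝕜]
    (S : Type*) [AddCommGroup S] [Module 𝕜 S] [Module (Ω →ₘ[P] 𝕜) S]
    [IsScalarTower 𝕜 (Ω →ₘ[P] 𝕜) S] where
  /-- the random norm `x ↦ ‖x‖` -/
  toFun : S → (Ω →ₘ[P] ℝ)
  nonneg : ∀ x, 0 ≤ toFun x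
  smul : ∀ (α : 𝕜) (x : S), toFun (α • x) = ‖α‖ • toFun x
  add_le : ∀ x y, toFun (x + y) ≤ toFun x + toFun y
  eq_zero : ∀ x, toFun x = 0 → x = 0
  l0_smul : ∀ (ξ : Ω →ₘ[P] 𝕜) (x : S), toFun (ξ • x) = L0.abs ξ * toFun x

namespace RandomNorm

variable {Ω : Type*} [MeasurableSpace Ω] {P : Measure Ω} {𝕜 : Type*} [RCLike 𝕜]
  {S : Type*} [AddCommGroup S] [Module 𝕜 S] [Module (Ω →ₘ[P] 𝕜) S]
  [IsScalarTower 𝕜 (Ω →ₘ[P] 𝕜) S]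

instance instCoeFun : CoeFun (RandomNorm P 𝕜 S) (fun _ => S → (Ω →ₘ[P] ℝ)) := ⟨toFun⟩

variable (N : RandomNorm P 𝕜 S)

/-! ### The `(ε, λ)`-topology and completeness -/

/-- The basic neighbourhood `N(ε, r) = {x | P{‖x‖ < ε} > 1 - r}` of the null element in the
`(ε, λ)`-topology (with `r` in the role of `λ`). -/
def nhdZero (ε r : ℝ) : Set S := {x | 1 - r < P.real {ω | N x ω < ε}}

/-- `u` is a Cauchy sequence for the `(ε, λ)`-topology. -/
def IsCauchySeq (u : ℕ → S) : Prop :=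
  ∀ ε > (0 : ℝ), ∀ r > (0 : ℝ), r < 1 → ∃ n₀, ∀ m ≥ n₀, ∀ n ≥ n₀, u m - u n ∈ N.nhdZero ε r

/-- `u` converges to `x` in the `(ε, λ)`-topology. -/
def ConvergesTo (u : ℕ → S) (x : S) : Prop :=
  ∀ ε > (0 : ℝ), ∀ r > (0 : ℝ), r < 1 → ∃ n₀, ∀ n ≥ n₀, u n - x ∈ N.nhdZero ε r

/-- Completeness for the `(ε, λ)`-topology.  This linear topology is metrizable, so sequences
suffice. -/
def IsComplete : Prop := ∀ u : ℕ → S, N.IsCauchySeq u → ∃ x, N.ConvergesTo u x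

/-! ### Random uniform convexity -/

/-- The random unit sphere `S(1)`: all `x` with `‖x‖ = I_A` for some event `A` with `P(A) > 0`. -/
def unitSphere : Set S :=
  {x | ∃ A : Set Ω, MeasurableSet A ∧ 0 < P A ∧ N x =ᵐ[P] A.indicator (fun _ => (1 : ℝ))}

/-- Random uniform convexity: for each number `ε ∈ (0, 2]` there is a number `δ ∈ (0, 1)` such that
for all `x, y ∈ S(1)` and each event `D` of positive probability with
`D ⊆ B_xy = [‖x‖ > 0] ∩ [‖y‖ > 0] ∩ [‖x - y‖ > 0]`, if `‖x - y‖ ≥ ε` on `D` then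
`‖x + y‖ ≤ 2 (1 - δ)` on `D`.  Inclusions and inequalities are almost sure. -/
def IsRandomUniformlyConvex : Prop :=
  ∀ ε : ℝ, 0 < ε → ε ≤ 2 → ∃ δ : ℝ, 0 < δ ∧ δ < 1 ∧
    ∀ x ∈ N.unitSphere, ∀ y ∈ N.unitSphere, ∀ D : Set Ω, MeasurableSet D → 0 < P D →
      (∀ᵐ ω ∂P, ω ∈ D → 0 < N x ω ∧ 0 < N y ω ∧ 0 < N (x - y) ω) →
      (∀ᵐ ω ∂P, ω ∈ D → ε ≤ N (x - y) ω) →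
      ∀ᵐ ω ∂P, ω ∈ D → N (x + y) ω ≤ 2 * (1 - δ)

/-! ### The normed space `L^p(S)` -/

theorem ae_nonneg (x : S) : ∀ᵐ ω ∂P, 0 ≤ N x ω := by
  filter_upwards [AEEqFun.coeFn_le.2 (N.nonneg x), AEEqFun.coeFn_zero (α := Ω) (μ := P) (β := ℝ)]
    with ω h h0
  simpa [h0] using h

theorem ae_add_le (x y : S) : ∀ᵐ ω ∂P, N (x + y) ω ≤ N x ω + N y ω := by
  filter_upwards [AEEqFun.coeFn_le.2 (N.add_le x y), AEEqFun.coeFn_add (N x) (N y)] with ω h h'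
  simpa [h'] using h

theorem ae_smul (α : 𝕜) (x : S) : N (α • x) =ᵐ[P] ‖α‖ • ⇑(N x) := by
  rw [N.smul]
  exact AEEqFun.coeFn_smul _ _

theorem map_zero : N 0 = 0 := by
  have h := N.smul (0 : 𝕜) 0
  simpa using h

theorem map_neg (x : S) : N (-x) = N x := by
  have h := N.smul (-1 : 𝕜) x
  simpa using h

theorem eLpNorm_add_le' (p : ℝ≥0∞) [hp : Fact (1 ≤ p)] (x y : S) :
    eLpNorm (N (x + y)) p P ≤ eLpNorm (N x) p P + eLpNorm (N y) p P := by
  refine le_trans (eLpNorm_mono_ae (g := ⇑(N x) + ⇑(N y)) ?_)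
    (eLpNorm_add_le (N x).aestronglyMeasurable (N y).aestronglyMeasurable hp.out)
  filter_upwards [N.ae_nonneg (x + y), N.ae_add_le x y] with ω h0 h
  rw [Real.norm_of_nonneg h0]
  exact h.trans (le_abs_self _)

theorem eLpNorm_smul' (p : ℝ≥0∞) (α : 𝕜) (x : S) :
    eLpNorm (N (α • x)) p P = ‖α‖ₑ * eLpNorm (N x) p P := by
  rw [eLpNorm_congr_ae (N.ae_smul α x), eLpNorm_const_smul, enorm_norm]

/-- `L^p(S)`: the `x ∈ S` whose random norm has a finite `L^p`-norm, that is (for `1 ≤ p < ∞`)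
`∫ ‖x‖^p dP < ∞`. -/
def lpSpace (p : ℝ≥0∞) [Fact (1 ≤ p)] : Submodule 𝕜 S where
  carrier := {x | eLpNorm (N x) p P < ∞}
  zero_mem' := by
    have h : eLpNorm (N (0 : S)) p P = 0 := by
      rw [N.map_zero, eLpNorm_congr_ae AEEqFun.coeFn_zero, eLpNorm_zero]
    simp [h]
  add_mem' := fun {x y} hx hy =>
    (N.eLpNorm_add_le' p x y).trans_lt (ENNReal.add_lt_top.2 ⟨hx, hy⟩)
  smul_mem' := fun α x hx => by
    simp only [Set.mem_ofPred_eq, N.eLpNorm_smul' p α x] at hx ⊢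
    exact ENNReal.mul_lt_top enorm_lt_top hx

/-- `L^p(S)` with the norm `‖x‖_p = (∫ ‖x‖^p dP)^(1/p)`. -/
noncomputable instance instNormedAddCommGroup (p : ℝ≥0∞) [hp : Fact (1 ≤ p)] :
    NormedAddCommGroup (N.lpSpace p) :=
  AddGroupNorm.toNormedAddCommGroup
    { toFun := fun x => (eLpNorm (N (x : S)) p P).toReal
      map_zero' := by
        have h : eLpNorm (N (0 : S)) p P = 0 := by
          rw [N.map_zero, eLpNorm_congr_ae AEEqFun.coeFn_zero, eLpNorm_zero]
        simp [h]
      add_le' := fun x y => by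
        have hx : eLpNorm (N (x : S)) p P ≠ ∞ := ne_of_lt x.2
        have hy : eLpNorm (N (y : S)) p P ≠ ∞ := ne_of_lt y.2
        rw [← ENNReal.toReal_add hx hy]
        exact ENNReal.toReal_mono (ENNReal.add_ne_top.2 ⟨hx, hy⟩)
          (N.eLpNorm_add_le' p (x : S) (y : S))
      neg' := fun x => by
        rw [Submodule.coe_neg, N.map_neg]
      eq_zero_of_map_eq_zero' := fun x hx => by
        have hfin : eLpNorm (N (x : S)) p P ≠ ∞ := ne_of_lt x.2
        have h0 : eLpNorm (N (x : S)) p P = 0 :=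
          ((ENNReal.toReal_eq_zero_iff _).1 hx).resolve_right hfin
        have hp0 : p ≠ 0 := (lt_of_lt_of_le zero_lt_one hp.out).ne'
        have h1 := (eLpNorm_eq_zero_iff (N (x : S)).aestronglyMeasurable hp0).1 h0
        exact Subtype.ext (N.eq_zero _ (AEEqFun.ext (h1.trans AEEqFun.coeFn_zero.symm))) }

theorem norm_def (p : ℝ≥0∞) [Fact (1 ≤ p)] (x : N.lpSpace p) :
    ‖x‖ = (eLpNorm (N (x : S)) p P).toReal := rfl

noncomputable instance instNormedSpace (p : ℝ≥0∞) [Fact (1 ≤ p)] :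
    NormedSpace 𝕜 (N.lpSpace p) where
  norm_smul_le := fun α x => by
    rw [N.norm_def, N.norm_def, Submodule.coe_smul, N.eLpNorm_smul' p α (x : S),
      ENNReal.toReal_mul, toReal_enorm]

end RandomNorm

/-!
The argument rests on a pointwise description of random uniform convexity.  Dividing `x` by its
random norm gives `u = RandomNorm.normalize x` with `‖u‖ = I_[‖x‖ > 0]`, an element of the random
unit sphere unless `x = 0`.  Hence a random uniformly convex `S` behaves, at almost every `ω`, like a
uniformly convex space with one and the same modulus
(`RandomNorm.IsRandomUniformlyConvex.exists_normalize`).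

*From `S` to `L^p(S)`.*  As for an ordinary uniformly convex space, `‖(x + y) / 2‖ ^ p` falls short
of `(‖x‖ ^ p + ‖y‖ ^ p) / 2` by a fixed proportion wherever `‖x - y‖ ≥ η max(‖x‖, ‖y‖)`: if the norms
of `x` and `y` are far apart this is strict convexity of `t ↦ t ^ p`, and if they are close, then `u`
and `v`, the normalizations of `x` and `y`, are far apart and convexity of the sphere applies
(`Real.exists_rpow_half_le_of_normalized`).  Where `‖x - y‖` is small its contribution is controlled
by `η`, so that almost surely
`‖(x + y) / 2‖ ^ p + θ ‖(x - y) / 2‖ ^ p ≤ (1 / 2 + θ (η / 2) ^ p) (‖x‖ ^ p + ‖y‖ ^ p)`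
(`RandomNorm.IsRandomUniformlyConvex.exists_rpow_add_le`), and integration gives the claim.

*From `L^p(S)` to `S`.*  If the bound on `‖x + y‖` failed on an event `E` of positive probability,
then `P(E) ^ (-1 / p) I_E x` and `P(E) ^ (-1 / p) I_E y` would be unit vectors violating uniform
convexity of `L^p(S)`, because `‖x‖ = ‖y‖ = 1` on `E`.

*Completeness.*  An `L^p`-Cauchy sequence is Cauchy for the `(ε, λ)`-topology by Markov's
inequality; its limit there is also its `L^p`-limit by Fatou's lemma along an almost surely
convergent subsequence.
-/

/-! ### Scalar inequalities -/

theorem Real.rpow_half_add_le {p : ℝ} (hp : 1 ≤ p) {a b : ℝ} (ha : 0 ≤ a) (hb : 0 ≤ b) :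
    ((a + b) / 2) ^ p ≤ (a ^ p + b ^ p) / 2 := by
  have h := (convexOn_rpow hp).2 (Set.mem_Ici.2 ha) (Set.mem_Ici.2 hb)
    (by norm_num : (0 : ℝ) ≤ 1 / 2) (by norm_num : (0 : ℝ) ≤ 1 / 2) (by norm_num)
  simp only [smul_eq_mul] at h
  calc ((a + b) / 2) ^ p = (1 / 2 * a + 1 / 2 * b) ^ p := by congr 1; ring
    _ ≤ 1 / 2 * a ^ p + 1 / 2 * b ^ p := h
    _ = (a ^ p + b ^ p) / 2 := by ring

/-- Strict convexity of `t ↦ t ^ p`, made uniform by compactness: the midpoint inequality gains a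
factor `1 - θ` as long as the two numbers differ by a fixed proportion. -/
theorem Real.exists_rpow_half_add_le {p : ℝ} (hp : 1 < p) {τ : ℝ} (hτ : 0 < τ) (hτ1 : τ ≤ 1) :
    ∃ θ : ℝ, 0 < θ ∧ ∀ a b : ℝ, 0 < a → 0 ≤ b → b ≤ (1 - τ) * a →
      ((a + b) / 2) ^ p ≤ (1 - θ) * ((a ^ p + b ^ p) / 2) := by
  have hp0 : 0 ≤ p := by linarith
  have hcont : ContinuousOn (fun t : ℝ => (1 + t ^ p) / 2 - ((1 + t) / 2) ^ p)
      (Set.Icc 0 (1 - τ)) :=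
    (((continuous_const.add (Real.continuous_rpow_const hp0)).div_const 2).sub
      ((Real.continuous_rpow_const hp0).comp
        ((continuous_const.add continuous_id).div_const 2))).continuousOn
  obtain ⟨s, hs, hmin⟩ := isCompact_Icc.exists_isMinOn
    (Set.nonempty_Icc.2 (by linarith : (0 : ℝ) ≤ 1 - τ)) hcont
  refine ⟨(1 + s ^ p) / 2 - ((1 + s) / 2) ^ p, ?_, fun a b ha hb hba => ?_⟩
  · have h := (strictConvexOn_rpow hp).2 (Set.mem_Ici.2 zero_le_one) (Set.mem_Ici.2 hs.1)
      (by linarith [hs.2] : (1 : ℝ) ≠ s)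
      (by norm_num : (0 : ℝ) < 1 / 2) (by norm_num : (0 : ℝ) < 1 / 2) (by norm_num)
    simp only [smul_eq_mul, Real.one_rpow] at h
    have h2 : (1 + s) / 2 = 1 / 2 * 1 + 1 / 2 * s := by ring
    rw [h2]
    linarith
  · have ht0 : 0 ≤ b / a := by positivity
    have ht1 : b / a ≤ 1 - τ := (div_le_iff₀ ha).2 hba
    have hm := hmin (show b / a ∈ Set.Icc 0 (1 - τ) from ⟨ht0, ht1⟩)
    set m := (1 + s ^ p) / 2 - ((1 + s) / 2) ^ p with hmdef
    have hm' : m ≤ (1 + (b / a) ^ p) / 2 - ((1 + b / a) / 2) ^ p := hm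
    have hm0 : 0 ≤ m := by
      have := Real.rpow_half_add_le hp.le zero_le_one hs.1
      rw [Real.one_rpow] at this
      linarith
    have hle1 : (b / a) ^ p ≤ 1 := Real.rpow_le_one ht0 (by linarith) hp0
    have hkey : ((1 + b / a) / 2) ^ p ≤ (1 - m) * ((1 + (b / a) ^ p) / 2) := by
      nlinarith [mul_nonneg hm0 (sub_nonneg.2 hle1)]
    have hap : 0 < a ^ p := Real.rpow_pos_of_pos ha p
    have e1 : ((a + b) / 2) ^ p = a ^ p * ((1 + b / a) / 2) ^ p := by
      rw [← Real.mul_rpow ha.le (by positivity)]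
      congr 1
      field_simp
    have e2 : b ^ p = a ^ p * (b / a) ^ p := by
      rw [← Real.mul_rpow ha.le ht0]
      congr 1
      field_simp
    rw [e1, e2]
    calc a ^ p * ((1 + b / a) / 2) ^ p
        ≤ a ^ p * ((1 - m) * ((1 + (b / a) ^ p) / 2)) := mul_le_mul_of_nonneg_left hkey hap.le
      _ = _ := by ring

/-- The scalar form of the passage from the unit sphere to arbitrary vectors.  Here `a`, `b`, `c`,
`d` stand for `‖x‖`, `‖y‖`, `‖x + y‖`, `‖x - y‖`, while `e` and `g` stand for `‖u - v‖` and
`‖u + v‖`, with `u` and `v` the normalizations of `x` and `y`. -/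
theorem Real.exists_rpow_half_le_of_normalized {p : ℝ} (hp : 1 < p) {η κ : ℝ} (hη : 0 < η)
    (hη1 : η ≤ 1) (hκ : 0 < κ) (hκ1 : κ < 1) :
    ∃ θ : ℝ, 0 < θ ∧ ∀ a b c d e g : ℝ, 0 < a → 0 ≤ b → b ≤ a → 0 ≤ c → c ≤ a + b →
      η * a ≤ d → d ≤ a * e + (a - b) → c ≤ b * g + (a - b) →
      (0 < b → η / 2 ≤ e → g ≤ 2 * (1 - κ)) →
      (c / 2) ^ p ≤ (1 - θ) * ((a ^ p + b ^ p) / 2) := by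
  obtain ⟨θ, hθ, H⟩ := Real.exists_rpow_half_add_le hp (τ := η / 2) (by linarith) (by linarith)
  have hp0 : 0 ≤ p := by linarith
  refine ⟨min θ (κ / 2), lt_min hθ (by linarith),
    fun a b c d e g ha hb hba hc hcab hd hde hcg h => ?_⟩
  have hM : 0 ≤ (a ^ p + b ^ p) / 2 := by positivity
  rcases le_total b ((1 - η / 2) * a) with hb1 | hb1
  · calc (c / 2) ^ p ≤ ((a + b) / 2) ^ p := by gcongr
      _ ≤ (1 - θ) * ((a ^ p + b ^ p) / 2) := H a b ha hb hb1
      _ ≤ _ := by gcongr; exact min_le_left _ _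
  · have hb0 : 0 < b := lt_of_lt_of_le (by nlinarith) hb1
    have he : η / 2 ≤ e := by
      have : η / 2 * a ≤ e * a := by linarith
      exact le_of_mul_le_mul_right this ha
    have hg := h hb0 he
    -- `b ≥ a / 2`, so the gain `2 κ b` is at least the proportion `κ / 2` of `a + b`.
    have hb2 : a ≤ 2 * b := by nlinarith
    have hc2 : c / 2 ≤ (1 - κ / 2) * ((a + b) / 2) := by
      have h1 : b * g ≤ b * (2 * (1 - κ)) := mul_le_mul_of_nonneg_left hg hb
      nlinarith [mul_nonneg hκ.le (sub_nonneg.2 hb2)]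
    calc (c / 2) ^ p ≤ ((1 - κ / 2) * ((a + b) / 2)) ^ p := by gcongr
      _ = (1 - κ / 2) ^ p * ((a + b) / 2) ^ p :=
          Real.mul_rpow (by linarith) (by linarith)
      _ ≤ (1 - κ / 2) * ((a ^ p + b ^ p) / 2) := by
          refine mul_le_mul ?_ (Real.rpow_half_add_le hp.le ha.le hb) (by positivity) (by linarith)
          exact Real.rpow_le_self_of_le_one (by linarith) (by linarith) hp.le
      _ ≤ _ := by gcongr; exact min_le_right _ _

/-! ### Multiplication by real random variables -/

section L0

variable {Ω : Type*} [MeasurableSpace Ω] {P : Measure Ω} {𝕜 : Type*} [RCLike 𝕜]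

/-- The class in `L⁰(ℱ, 𝕜)` of a real random variable. -/
noncomputable def L0.ofReal (𝕜 : Type*) [RCLike 𝕜] (f : Ω → ℝ) (hf : AEStronglyMeasurable f P) :
    Ω →ₘ[P] 𝕜 :=
  AEEqFun.mk (fun ω => (f ω : 𝕜)) (RCLike.continuous_ofReal.comp_aestronglyMeasurable hf)

theorem L0.ofReal_sub {f g : Ω → ℝ} (hf : AEStronglyMeasurable f P)
    (hg : AEStronglyMeasurable g P) :
    L0.ofReal 𝕜 f hf - L0.ofReal 𝕜 g hg = L0.ofReal 𝕜 (f - g) (hf.sub hg) := by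
  unfold L0.ofReal
  refine (AEEqFun.mk_sub _ _ _ _).symm.trans (AEEqFun.mk_eq_mk.2 (.of_forall fun ω => ?_))
  simp

theorem L0.ofReal_mul {f g : Ω → ℝ} (hf : AEStronglyMeasurable f P)
    (hg : AEStronglyMeasurable g P) :
    L0.ofReal 𝕜 f hf * L0.ofReal 𝕜 g hg = L0.ofReal 𝕜 (f * g) (hf.mul hg) := by
  unfold L0.ofReal
  refine (AEEqFun.mk_mul_mk _ _ _ _).trans (AEEqFun.mk_eq_mk.2 (.of_forall fun ω => ?_))
  simp

theorem L0.ofReal_one : L0.ofReal 𝕜 (1 : Ω → ℝ) aestronglyMeasurable_one = (1 : Ω →ₘ[P] 𝕜) := by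
  refine AEEqFun.mk_eq_mk.2 (.of_forall fun ω => ?_)
  simp

end L0

namespace RandomNorm

variable {Ω : Type*} [MeasurableSpace Ω] {P : Measure Ω} {𝕜 : Type*} [RCLike 𝕜]
  {S : Type*} [AddCommGroup S] [Module 𝕜 S] [Module (Ω →ₘ[P] 𝕜) S]
  [IsScalarTower 𝕜 (Ω →ₘ[P] 𝕜) S] (N : RandomNorm P 𝕜 S)

theorem ae_ofReal_smul {f : Ω → ℝ} (hf : AEStronglyMeasurable f P) (x : S) :
    ∀ᵐ ω ∂P, N (L0.ofReal 𝕜 f hf • x) ω = |f ω| * N x ω := by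
  rw [N.l0_smul]
  have h1 := AEEqFun.coeFn_mul (L0.abs (L0.ofReal 𝕜 f hf)) (N x)
  have h2 := AEEqFun.coeFn_comp (fun z : 𝕜 => ‖z‖) continuous_norm (L0.ofReal 𝕜 f hf)
  have h3 := AEEqFun.coeFn_mk (fun ω => (f ω : 𝕜))
    (RCLike.continuous_ofReal.comp_aestronglyMeasurable hf)
  filter_upwards [h1, h2, h3] with ω h1 h2 h3
  refine h1.trans ?_
  rw [Pi.mul_apply]
  congr 1
  refine h2.trans ?_
  have h3' : (L0.ofReal 𝕜 f hf) ω = (f ω : 𝕜) := h3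
  simp [h3']

theorem ae_sub_le (x y : S) : ∀ᵐ ω ∂P, N (x - y) ω ≤ N x ω + N y ω := by
  have h := N.ae_add_le x (-y)
  rwa [← sub_eq_add_neg, N.map_neg] at h

theorem map_sub_comm (x y : S) : N (x - y) = N (y - x) := by
  rw [← N.map_neg, neg_sub]

theorem eq_of_ae_eq_zero {x y : S} (h : ∀ᵐ ω ∂P, N (x - y) ω = 0) : x = y := by
  refine sub_eq_zero.1 (N.eq_zero _ (AEEqFun.ext ?_))
  filter_upwards [h, AEEqFun.coeFn_zero (α := Ω) (μ := P) (β := ℝ)] with ω h h0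
  rw [h, h0]; rfl

/-- `x` divided by its random norm; this is zero on the event `‖x‖ = 0`, as `0⁻¹ = 0`. -/
noncomputable def normalize (x : S) : S :=
  L0.ofReal (P := P) 𝕜 (⇑(N x))⁻¹ (N x).measurable.inv.aestronglyMeasurable • x

theorem ae_normalize (x : S) :
    N (N.normalize x) =ᵐ[P] {ω | 0 < N x ω}.indicator (fun _ => (1 : ℝ)) := by
  filter_upwards [N.ae_ofReal_smul (N x).measurable.inv.aestronglyMeasurable x, N.ae_nonneg x]
    with ω h h0
  refine h.trans ?_
  rcases h0.eq_or_lt with h1 | h1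
  · simp [← h1]
  · rw [Set.indicator_of_mem (by exact h1), Pi.inv_apply, abs_of_pos (inv_pos.2 h1),
      inv_mul_cancel₀ h1.ne']

theorem ae_normalize_le_one (x : S) : ∀ᵐ ω ∂P, N (N.normalize x) ω ≤ 1 := by
  filter_upwards [N.ae_normalize x] with ω h
  rw [h]
  exact Set.indicator_le_self' (fun _ _ => zero_le_one) ω

theorem norm_smul_normalize (x : S) :
    L0.ofReal 𝕜 (N x) (N x).aestronglyMeasurable • N.normalize x = x := by
  refine N.eq_of_ae_eq_zero ?_
  have hf : AEStronglyMeasurable (⇑(N x) * (⇑(N x))⁻¹) P :=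
    (N x).aestronglyMeasurable.mul (N x).measurable.inv.aestronglyMeasurable
  have key : L0.ofReal 𝕜 (N x) (N x).aestronglyMeasurable • N.normalize x - x =
      L0.ofReal 𝕜 (⇑(N x) * (⇑(N x))⁻¹ - 1) (hf.sub aestronglyMeasurable_one) • x := by
    rw [← L0.ofReal_sub hf aestronglyMeasurable_one, L0.ofReal_one, sub_smul, one_smul, normalize,
      smul_smul, L0.ofReal_mul]
  rw [key]
  filter_upwards [N.ae_ofReal_smul (hf.sub aestronglyMeasurable_one) x] with ω h
  rw [h]
  rcases eq_or_ne (N x ω) 0 with h0 | h0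
  · simp [h0]
  · simp [h0]

/-! ### Random uniform convexity in arbitrary position -/

variable {N}

theorem IsRandomUniformlyConvex.exists_normalize (hS : N.IsRandomUniformlyConvex) {ε : ℝ}
    (hε : 0 < ε) (hε2 : ε ≤ 2) : ∃ δ : ℝ, 0 < δ ∧ δ < 1 ∧ ∀ x y : S, ∀ᵐ ω ∂P,
      0 < N x ω → 0 < N y ω → ε ≤ N (N.normalize x - N.normalize y) ω →
        N (N.normalize x + N.normalize y) ω ≤ 2 * (1 - δ) := by
  obtain ⟨δ, hδ, hδ1, H⟩ := hS ε hε hε2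
  refine ⟨δ, hδ, hδ1, fun x y => ?_⟩
  set D : Set Ω := {ω | 0 < N x ω} ∩ {ω | 0 < N y ω} ∩
    {ω | ε ≤ N (N.normalize x - N.normalize y) ω} with hD
  have hmx : MeasurableSet {ω | 0 < N x ω} := measurableSet_lt measurable_const (N x).measurable
  have hmy : MeasurableSet {ω | 0 < N y ω} := measurableSet_lt measurable_const (N y).measurable
  have hDm : MeasurableSet D := (hmx.inter hmy).inter
    (measurableSet_le measurable_const (N (N.normalize x - N.normalize y)).measurable)
  rcases eq_or_ne (P D) 0 with h0 | h0
  · filter_upwards [measure_eq_zero_iff_ae_notMem.1 h0] with ω hω h1 h2 h3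
    exact absurd ⟨⟨h1, h2⟩, h3⟩ hω
  · have hpos : 0 < P D := pos_iff_ne_zero.2 h0
    have hx : N.normalize x ∈ N.unitSphere :=
      ⟨_, hmx, hpos.trans_le (measure_mono fun ω h => h.1.1), N.ae_normalize x⟩
    have hy : N.normalize y ∈ N.unitSphere :=
      ⟨_, hmy, hpos.trans_le (measure_mono fun ω h => h.1.2), N.ae_normalize y⟩
    have h := H _ hx _ hy D hDm hpos ?_ (.of_forall fun ω h => h.2)
    · filter_upwards [h] with ω h h1 h2 h3
      exact h ⟨⟨h1, h2⟩, h3⟩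
    · filter_upwards [N.ae_normalize x, N.ae_normalize y] with ω h1 h2 hω
      rw [h1, h2, Set.indicator_of_mem hω.1.1, Set.indicator_of_mem hω.1.2]
      exact ⟨one_pos, one_pos, hε.trans_le hω.2⟩

/-- The two triangle inequalities comparing `x ± y` with `u ± v`, for `u`, `v` the normalizations
of `x`, `y`: they come from `x - y = ‖x‖ (u - v) + (‖x‖ - ‖y‖) v` and
`x + y = ‖y‖ (u + v) + (‖x‖ - ‖y‖) u`. -/
theorem ae_le_normalize (N : RandomNorm P 𝕜 S) (x y : S) : ∀ᵐ ω ∂P, N y ω ≤ N x ω →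
    N (x - y) ω ≤ N x ω * N (N.normalize x - N.normalize y) ω + (N x ω - N y ω) ∧
    N (x + y) ω ≤ N y ω * N (N.normalize x + N.normalize y) ω + (N x ω - N y ω) := by
  set u := N.normalize x with hu
  set v := N.normalize y with hv
  have hmx := (N x).aestronglyMeasurable
  have hmy := (N y).aestronglyMeasurable
  have hxu : L0.ofReal 𝕜 (N x) hmx • u = x := N.norm_smul_normalize x
  have hyv : L0.ofReal 𝕜 (N y) hmy • v = y := N.norm_smul_normalize y
  have e1 : x - y = L0.ofReal 𝕜 (N x) hmx • (u - v) +
      L0.ofReal 𝕜 (⇑(N x) - ⇑(N y)) (hmx.sub hmy) • v := by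
    rw [← L0.ofReal_sub hmx hmy, smul_sub, sub_smul, hxu, hyv]; abel
  have e2 : x + y = L0.ofReal 𝕜 (N y) hmy • (u + v) +
      L0.ofReal 𝕜 (⇑(N x) - ⇑(N y)) (hmx.sub hmy) • u := by
    rw [← L0.ofReal_sub hmx hmy, smul_add, sub_smul, hxu, hyv]; abel
  have t1 := N.ae_add_le (L0.ofReal 𝕜 (N x) hmx • (u - v))
    (L0.ofReal 𝕜 (⇑(N x) - ⇑(N y)) (hmx.sub hmy) • v)
  have t2 := N.ae_add_le (L0.ofReal 𝕜 (N y) hmy • (u + v))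
    (L0.ofReal 𝕜 (⇑(N x) - ⇑(N y)) (hmx.sub hmy) • u)
  rw [← e1] at t1
  rw [← e2] at t2
  filter_upwards [t1, t2, N.ae_ofReal_smul hmx (u - v), N.ae_ofReal_smul hmy (u + v),
    N.ae_ofReal_smul (hmx.sub hmy) u, N.ae_ofReal_smul (hmx.sub hmy) v, N.ae_nonneg x,
    N.ae_nonneg y, N.ae_normalize_le_one x, N.ae_normalize_le_one y]
    with ω t1 t2 s1 s2 s3 s4 hx hy hu1 hv1 hle
  rw [s1, s4, Pi.sub_apply, abs_of_nonneg hx, abs_of_nonneg (sub_nonneg.2 hle)] at t1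
  rw [s2, s3, Pi.sub_apply, abs_of_nonneg hy, abs_of_nonneg (sub_nonneg.2 hle)] at t2
  exact ⟨t1.trans (add_le_add_right (mul_le_of_le_one_right (sub_nonneg.2 hle) hv1) _),
    t2.trans (add_le_add_right (mul_le_of_le_one_right (sub_nonneg.2 hle) hu1) _)⟩

theorem IsRandomUniformlyConvex.exists_rpow_le (hS : N.IsRandomUniformlyConvex) {p : ℝ}
    (hp : 1 < p) {η : ℝ} (hη : 0 < η) (hη1 : η ≤ 1) : ∃ θ : ℝ, 0 < θ ∧ ∀ x y : S, ∀ᵐ ω ∂P,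
      η * max (N x ω) (N y ω) ≤ N (x - y) ω →
        (N (x + y) ω / 2) ^ p ≤ (1 - θ) * ((N x ω ^ p + N y ω ^ p) / 2) := by
  obtain ⟨κ, hκ, hκ1, H⟩ := hS.exists_normalize (half_pos hη) (by linarith)
  obtain ⟨θ, hθ, T⟩ := Real.exists_rpow_half_le_of_normalized hp hη hη1 hκ hκ1
  -- It is enough to treat the event `‖y‖ ≤ ‖x‖`; the other one follows by exchanging `x` and `y`.
  have main : ∀ x y : S, ∀ᵐ ω ∂P, N y ω ≤ N x ω → η * N x ω ≤ N (x - y) ω →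
      (N (x + y) ω / 2) ^ p ≤ (1 - θ) * ((N x ω ^ p + N y ω ^ p) / 2) := by
    intro x y
    filter_upwards [H x y, N.ae_le_normalize x y, N.ae_nonneg x, N.ae_nonneg y,
      N.ae_nonneg (x + y), N.ae_add_le x y] with ω h1 h2 hx hy hxy hadd hle hd
    rcases hx.eq_or_lt with h0 | h0
    · have hy0 : N y ω = 0 := le_antisymm (h0 ▸ hle) hy
      have hxy0 : N (x + y) ω = 0 := le_antisymm (by linarith) hxy
      rw [hxy0, ← h0, hy0, zero_div, Real.zero_rpow (by linarith)]
      simp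
    · exact T _ _ _ _ _ _ h0 hy hle hxy hadd hd (h2 hle).1 (h2 hle).2 fun hb => h1 h0 hb
  refine ⟨θ, hθ, fun x y => ?_⟩
  have h2 := main y x
  rw [N.map_sub_comm, add_comm] at h2
  filter_upwards [main x y, h2] with ω h1 h2 hd
  rcases le_total (N y ω) (N x ω) with h | h
  · exact h1 h (by rwa [max_eq_left h] at hd)
  · rw [add_comm (N x ω ^ p)]
    exact h2 h (by rwa [max_eq_right h] at hd)

/-- A form that can be integrated without distinguishing the event on which
`‖x - y‖ ≥ η max(‖x‖, ‖y‖)` from its complement. -/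
theorem IsRandomUniformlyConvex.exists_rpow_add_le (hS : N.IsRandomUniformlyConvex) {p : ℝ}
    (hp : 1 < p) {η : ℝ} (hη : 0 < η) (hη1 : η ≤ 1) : ∃ θ : ℝ, 0 < θ ∧ ∀ x y : S, ∀ᵐ ω ∂P,
      (N (x + y) ω / 2) ^ p + θ * (N (x - y) ω / 2) ^ p ≤
        (1 / 2 + θ * (η / 2) ^ p) * (N x ω ^ p + N y ω ^ p) := by
  obtain ⟨θ, hθ, H⟩ := hS.exists_rpow_le hp hη hη1
  refine ⟨θ, hθ, fun x y => ?_⟩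
  filter_upwards [H x y, N.ae_nonneg x, N.ae_nonneg y, N.ae_nonneg (x + y), N.ae_nonneg (x - y),
    N.ae_add_le x y, N.ae_sub_le x y] with ω h hx hy hxy hd hadd hsub
  have hmean := Real.rpow_half_add_le hp.le hx hy
  have hp0 : 0 ≤ p := by linarith
  have hxp : 0 ≤ N x ω ^ p := Real.rpow_nonneg hx p
  have hyp : 0 ≤ N y ω ^ p := Real.rpow_nonneg hy p
  have hηp : 0 ≤ (η / 2) ^ p := by positivity
  rcases le_total (η * max (N x ω) (N y ω)) (N (x - y) ω) with hle | hle
  · have h1 := h hle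
    have h2 : (N (x - y) ω / 2) ^ p ≤ (N x ω ^ p + N y ω ^ p) / 2 :=
      le_trans (by gcongr) hmean
    have h3 := mul_le_mul_of_nonneg_left h2 hθ.le
    have h4 : 0 ≤ θ * (η / 2) ^ p * (N x ω ^ p + N y ω ^ p) := by positivity
    linarith
  · have h1 : (N (x + y) ω / 2) ^ p ≤ (N x ω ^ p + N y ω ^ p) / 2 :=
      le_trans (by gcongr) hmean
    have hmax : max (N x ω) (N y ω) ^ p ≤ N x ω ^ p + N y ω ^ p := by
      rcases max_choice (N x ω) (N y ω) with e | e <;> rw [e] <;> linarith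
    have h2 : (N (x - y) ω / 2) ^ p ≤ (η / 2) ^ p * (N x ω ^ p + N y ω ^ p) :=
      calc (N (x - y) ω / 2) ^ p ≤ (η / 2 * max (N x ω) (N y ω)) ^ p := by
            gcongr; linarith
        _ = (η / 2) ^ p * max (N x ω) (N y ω) ^ p :=
            Real.mul_rpow (by positivity) (le_max_of_le_left hx)
        _ ≤ _ := by gcongr
    have h3 := mul_le_mul_of_nonneg_left h2 hθ.le
    linarith

end RandomNorm

namespace RandomNorm

variable {Ω : Type*} [MeasurableSpace Ω] {P : Measure Ω} {𝕜 : Type*} [RCLike 𝕜]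
  {S : Type*} [AddCommGroup S] [Module 𝕜 S] [Module (Ω →ₘ[P] 𝕜) S]
  [IsScalarTower 𝕜 (Ω →ₘ[P] 𝕜) S] (N : RandomNorm P 𝕜 S)

/-! ### The norm of `L^p(S)` as an integral -/

theorem memLp_of_mem_lpSpace {p : ℝ≥0∞} [Fact (1 ≤ p)] (x : N.lpSpace p) : MemLp (N (x : S)) p P :=
  ⟨(N (x : S)).aestronglyMeasurable, x.2⟩

theorem ofReal_norm_lpSpace {p : ℝ≥0∞} [Fact (1 ≤ p)] (x : N.lpSpace p) :
    ENNReal.ofReal ‖x‖ = eLpNorm (N (x : S)) p P := by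
  rw [N.norm_def, ENNReal.ofReal_toReal (N.memLp_of_mem_lpSpace x).2.ne]

theorem integrable_rpow {p : ℝ≥0∞} [hp : Fact (1 ≤ p)] (hp_top : p ≠ ∞) (x : N.lpSpace p) :
    Integrable (fun ω => N (x : S) ω ^ p.toReal) P := by
  refine ((N.memLp_of_mem_lpSpace x).integrable_norm_rpow
    (zero_lt_one.trans_le hp.out).ne' hp_top).congr ?_
  filter_upwards [N.ae_nonneg (x : S)] with ω h
  rw [Real.norm_of_nonneg h]

theorem norm_rpow_eq_integral {p : ℝ≥0∞} [hp : Fact (1 ≤ p)] (hp_top : p ≠ ∞) (x : N.lpSpace p) :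
    ‖x‖ ^ p.toReal = ∫ ω, N (x : S) ω ^ p.toReal ∂P := by
  have hp0 : p ≠ 0 := (zero_lt_one.trans_le hp.out).ne'
  have h : ∫ ω, ‖N (x : S) ω‖ ^ p.toReal ∂P = ∫ ω, N (x : S) ω ^ p.toReal ∂P := by
    refine integral_congr_ae ?_
    filter_upwards [N.ae_nonneg (x : S)] with ω h
    rw [Real.norm_of_nonneg h]
  have hI : 0 ≤ ∫ ω, ‖N (x : S) ω‖ ^ p.toReal ∂P := integral_nonneg fun ω => by positivity
  rw [N.norm_def, (N.memLp_of_mem_lpSpace x).eLpNorm_eq_integral_rpow_norm hp0 hp_top,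
    ENNReal.toReal_ofReal (by positivity), Real.rpow_inv_rpow hI
      (ENNReal.toReal_pos hp0 hp_top).ne', h]

/-! ### Completeness of `L^p(S)` -/

section Complete

variable [IsProbabilityMeasure P]

theorem mem_nhdZero_iff (x : S) (ε r : ℝ) :
    x ∈ N.nhdZero ε r ↔ P.real {ω | ε ≤ N x ω} < r := by
  have hm : MeasurableSet {ω | N x ω < ε} := measurableSet_lt (N x).measurable measurable_const
  have hc : {ω | ε ≤ N x ω} = {ω | N x ω < ε}ᶜ := by ext; simp
  rw [hc, probReal_compl_eq_one_sub hm]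
  change 1 - r < P.real {ω | N x ω < ε} ↔ _
  constructor <;> intro h <;> linarith

theorem tendstoInMeasure_norm_iff {ι : Type*} {l : Filter ι} (u : ι → S) :
    TendstoInMeasure P (fun i => ⇑(N (u i))) l 0 ↔
      ∀ ε > (0 : ℝ), ∀ r > (0 : ℝ), r < 1 → ∀ᶠ i in l, u i ∈ N.nhdZero ε r := by
  have hset : ∀ (ε : ℝ) (i : ι), P.real {ω | ε ≤ ‖N (u i) ω - (0 : Ω → ℝ) ω‖} =
      P.real {ω | ε ≤ N (u i) ω} := fun ε i => by
    refine measureReal_congr ?_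
    filter_upwards [N.ae_nonneg (u i)] with ω h
    refine propext ?_
    change ε ≤ ‖N (u i) ω - 0‖ ↔ ε ≤ N (u i) ω
    rw [sub_zero, Real.norm_of_nonneg h]
  rw [tendstoInMeasure_iff_measureReal_norm]
  simp only [hset, mem_nhdZero_iff]
  refine forall₂_congr fun ε hε => ⟨fun h r hr _ => h.eventually_lt_const hr, fun h => ?_⟩
  refine tendsto_order.2 ⟨fun a ha => .of_forall fun i => ha.trans_le measureReal_nonneg,
    fun a ha => ?_⟩
  filter_upwards [h (min a (1 / 2)) (lt_min ha (by norm_num))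
    ((min_le_right _ _).trans_lt (by norm_num))] with i hi
  exact hi.trans_le (min_le_left _ _)

/-- An `L^p`-Cauchy sequence is Cauchy for the `(ε, λ)`-topology, by Markov's inequality. -/
theorem isCauchySeq_of_cauchySeq {p : ℝ≥0∞} [hp : Fact (1 ≤ p)] {u : ℕ → N.lpSpace p}
    (hu : CauchySeq u) : N.IsCauchySeq fun n => (u n : S) := by
  have h : TendstoInMeasure P (fun i : ℕ × ℕ => ⇑(N ((u i.1 : S) - u i.2))) Filter.atTop 0 := by
    refine tendstoInMeasure_of_tendsto_eLpNorm (p := p) (zero_lt_one.trans_le hp.out).ne'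
      (fun i => (N _).aestronglyMeasurable) aestronglyMeasurable_zero ?_
    have h1 := ENNReal.tendsto_ofReal (cauchySeq_iff_tendsto_dist_atTop_0.1 hu)
    rw [ENNReal.ofReal_zero] at h1
    refine h1.congr fun i => ?_
    rw [dist_eq_norm, N.ofReal_norm_lpSpace, sub_zero]
    rfl
  intro ε hε r hr hr1
  obtain ⟨⟨a, b⟩, hab⟩ := Filter.eventually_atTop.1
    ((N.tendstoInMeasure_norm_iff _).1 h ε hε r hr hr1)
  exact ⟨max a b, fun m hm n hn =>
    hab (m, n) ⟨(le_max_left _ _).trans hm, (le_max_right _ _).trans hn⟩⟩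

/-- Fatou's lemma for the `(ε, λ)`-topology. -/
theorem eLpNorm_sub_le_of_convergesTo {p : ℝ≥0∞} {u : ℕ → S} {x y : S} (h : N.ConvergesTo u x)
    {C : ℝ≥0∞} (hC : ∀ᶠ n in Filter.atTop, eLpNorm (N (y - u n)) p P ≤ C) :
    eLpNorm (N (y - x)) p P ≤ C := by
  have hm : TendstoInMeasure P (fun n => ⇑(N (u n - x))) Filter.atTop 0 :=
    (N.tendstoInMeasure_norm_iff _).2 fun ε hε r hr hr1 =>
      Filter.eventually_atTop.2 (h ε hε r hr hr1)
  obtain ⟨ns, hns, hlim⟩ := hm.exists_seq_tendsto_ae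
  have hbound : ∀ᵐ ω ∂P, ∀ n, |N (y - u n) ω - N (y - x) ω| ≤ N (u n - x) ω := by
    refine ae_all_iff.2 fun n => ?_
    have h1 := N.ae_add_le (y - u n) (u n - x)
    have h2 := N.ae_sub_le (y - x) (u n - x)
    rw [sub_add_sub_cancel] at h1
    rw [sub_sub_sub_cancel_right] at h2
    filter_upwards [h1, h2] with ω h1 h2
    exact abs_sub_le_iff.2 ⟨by linarith, by linarith⟩
  have hlim' : ∀ᵐ ω ∂P, Filter.Tendsto (fun k => N (y - u (ns k)) ω) Filter.atTop
      (nhds (N (y - x) ω)) := by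
    filter_upwards [hlim, hbound] with ω h1 h2
    rw [tendsto_iff_norm_sub_tendsto_zero]
    exact squeeze_zero (fun _ => norm_nonneg _) (fun k => h2 (ns k)) h1
  refine (Lp.eLpNorm_lim_le_liminf_eLpNorm (fun k => (N _).aestronglyMeasurable) _ hlim').trans ?_
  exact Filter.liminf_le_of_frequently_le'
    ((hns.tendsto_atTop.eventually hC).frequently)

theorem completeSpace_lpSpace (hN : N.IsComplete) (p : ℝ≥0∞) [Fact (1 ≤ p)] :
    CompleteSpace (N.lpSpace p) := by
  refine Metric.complete_of_cauchySeq_tendsto fun u hu => ?_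
  obtain ⟨x, hx⟩ := hN _ (N.isCauchySeq_of_cauchySeq hu)
  have key : ∀ ε > (0 : ℝ), ∃ n₀, ∀ n ≥ n₀, eLpNorm (N ((u n : S) - x)) p P ≤ ENNReal.ofReal ε := by
    intro ε hε
    obtain ⟨n₀, h⟩ := Metric.cauchySeq_iff.1 hu ε hε
    refine ⟨n₀, fun n hn => N.eLpNorm_sub_le_of_convergesTo hx ?_⟩
    filter_upwards [Filter.eventually_ge_atTop n₀] with k hk
    have h1 := h n hn k hk
    rw [dist_eq_norm] at h1
    rw [← Submodule.coe_sub, ← N.ofReal_norm_lpSpace]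
    exact ENNReal.ofReal_le_ofReal h1.le
  have hxmem : x ∈ N.lpSpace p := by
    obtain ⟨n₀, h⟩ := key 1 one_pos
    have h1 : (u n₀ : S) - x ∈ N.lpSpace p := (h n₀ le_rfl).trans_lt ENNReal.ofReal_lt_top
    simpa using (N.lpSpace p).sub_mem (u n₀).2 h1
  refine ⟨⟨x, hxmem⟩, Metric.tendsto_atTop.2 fun ε hε => ?_⟩
  obtain ⟨n₀, h⟩ := key (ε / 2) (half_pos hε)
  refine ⟨n₀, fun n hn => lt_of_le_of_lt ?_ (half_lt_self hε)⟩
  rw [dist_eq_norm, ← ENNReal.ofReal_le_ofReal_iff (half_pos hε).le, N.ofReal_norm_lpSpace]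
  exact h n hn

end Complete

/-! ### Random uniform convexity of `S` implies uniform convexity of `L^p(S)` -/

variable {N}

theorem IsRandomUniformlyConvex.uniformConvexSpace (hS : N.IsRandomUniformlyConvex)
    {p : ℝ≥0∞} [Fact (1 ≤ p)] (hp : 1 < p) (hp_top : p ≠ ∞) :
    UniformConvexSpace (N.lpSpace p) := by
  have hq : 1 < p.toReal := by
    rw [← ENNReal.toReal_one]
    exact (ENNReal.toReal_lt_toReal ENNReal.one_ne_top hp_top).2 hp
  set q := p.toReal with hqdef
  have hq0 : 0 < q := by linarith
  refine ⟨fun ε hε => ?_⟩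
  set ε' := min ε 1 with hε'
  have hε'0 : 0 < ε' := lt_min hε one_pos
  have hε'1 : ε' ≤ 1 := min_le_right _ _
  obtain ⟨θ, hθ, H⟩ := hS.exists_rpow_add_le hq (η := ε' / 2) (by linarith) (by linarith)
  -- With `η = ε' / 2` the error term `2 θ (η / 2) ^ q` is less than the gain `θ (ε' / 2) ^ q`.
  set k := θ * (ε' / 2) ^ q - 2 * (θ * (ε' / 2 / 2) ^ q) with hk
  have hk0 : 0 < k := by
    have h1 : (ε' / 2 / 2) ^ q = (ε' / 2) ^ q * (1 / 2) ^ q := by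
      rw [← Real.mul_rpow (by positivity) (by norm_num)]; ring_nf
    have h2 : (1 / 2 : ℝ) ^ q < 1 / 2 := by
      simpa using Real.rpow_lt_rpow_of_exponent_gt (by norm_num : (0 : ℝ) < 1 / 2)
        (by norm_num) hq
    have h3 : 0 < θ * (ε' / 2) ^ q := by positivity
    rw [hk, h1]
    nlinarith
  refine ⟨2 * (1 - (max 0 (1 - k)) ^ q⁻¹), ?_, fun x hx y hy hxy => ?_⟩
  · have : (max 0 (1 - k)) ^ q⁻¹ < 1 :=
      Real.rpow_lt_one (le_max_left _ _) (max_lt one_pos (by linarith)) (inv_pos.2 hq0)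
    linarith
  · have i1 := N.integrable_rpow hp_top (x + y)
    have i2 := N.integrable_rpow hp_top (x - y)
    have i3 := N.integrable_rpow hp_top x
    have i4 := N.integrable_rpow hp_top y
    have n1 := N.norm_rpow_eq_integral hp_top (x + y)
    have n2 := N.norm_rpow_eq_integral hp_top (x - y)
    have n3 := N.norm_rpow_eq_integral hp_top x
    have n4 := N.norm_rpow_eq_integral hp_top y
    rw [← hqdef] at i1 i2 i3 i4 n1 n2 n3 n4
    have hint : ∫ ω, (N ((x + y : N.lpSpace p) : S) ω ^ q / 2 ^ q +
        θ * (N ((x - y : N.lpSpace p) : S) ω ^ q / 2 ^ q)) ∂P ≤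
        ∫ ω, (1 / 2 + θ * (ε' / 2 / 2) ^ q) * (N (x : S) ω ^ q + N (y : S) ω ^ q) ∂P := by
      refine integral_mono_ae ((i1.div_const _).add ((i2.div_const _).const_mul _))
        ((i3.add i4).const_mul _) ?_
      filter_upwards [H x y, N.ae_nonneg ((x : S) + y), N.ae_nonneg ((x : S) - y)] with ω h h1 h2
      rw [Real.div_rpow h1 zero_le_two, Real.div_rpow h2 zero_le_two] at h
      exact h
    rw [integral_add (i1.div_const _) ((i2.div_const _).const_mul _), integral_const_mul,
      integral_div, integral_div, integral_const_mul, integral_add i3 i4, ← n1, ← n2, ← n3, ← n4,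
      hx, hy, Real.one_rpow, ← Real.div_rpow (norm_nonneg _) zero_le_two,
      ← Real.div_rpow (norm_nonneg _) zero_le_two] at hint
    have hd : (ε' / 2) ^ q ≤ (‖x - y‖ / 2) ^ q := by
      have := (min_le_left ε 1).trans hxy
      gcongr
    have hd' := mul_le_mul_of_nonneg_left hd hθ.le
    have hfin : (‖x + y‖ / 2) ^ q ≤ max 0 (1 - k) := le_max_of_le_right (by linarith)
    have := (Real.le_rpow_inv_iff_of_pos (by positivity) (le_max_left _ _) hq0).2 hfin
    linarith

/-! ### Uniform convexity of `L^p(S)` implies random uniform convexity of `S` -/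

/-- Bounds for `‖z‖` on an event `E` become bounds for the `L^p(S)`-norm after restriction to `E`
and division by `P(E)^(1/p)`. -/
theorem eLpNorm_ofReal_indicator_smul {p : ℝ≥0∞} (hp0 : p ≠ 0) (hp_top : p ≠ ∞)
    [IsFiniteMeasure P] (N : RandomNorm P 𝕜 S) {E : Set Ω} (hE : MeasurableSet E) (hPE : P E ≠ 0)
    (hf : AEStronglyMeasurable (E.indicator fun _ => P.real E ^ (-p.toReal⁻¹)) P) (z : S) {s : ℝ}
    (hs : 0 ≤ s) :
    ((∀ᵐ ω ∂P, ω ∈ E → s ≤ N z ω) →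
      ENNReal.ofReal s ≤ eLpNorm (N (L0.ofReal 𝕜 _ hf • z)) p P) ∧
    ((∀ᵐ ω ∂P, ω ∈ E → N z ω ≤ s) →
      eLpNorm (N (L0.ofReal 𝕜 _ hf • z)) p P ≤ ENNReal.ofReal s) := by
  set c := P.real E ^ (-p.toReal⁻¹) with hc
  have hPE' : 0 < P.real E := ENNReal.toReal_pos hPE (measure_ne_top P E)
  have hc0 : 0 < c := Real.rpow_pos_of_pos hPE' _
  have hnorm : eLpNorm (E.indicator fun _ => s * c) p P = ENNReal.ofReal s := by
    rw [eLpNorm_indicator_const hE hp0 hp_top, Real.enorm_of_nonneg (by positivity),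
      ← ofReal_measureReal (measure_ne_top P E), ENNReal.ofReal_rpow_of_pos hPE',
      ← ENNReal.ofReal_mul (by positivity), mul_assoc, hc, ← Real.rpow_add hPE']
    simp
  have hz := N.ae_ofReal_smul hf z
  constructor <;> intro h
  · rw [← hnorm]
    refine eLpNorm_mono_ae ?_
    filter_upwards [hz, h] with ω h1 h2
    rw [h1]
    by_cases hω : ω ∈ E
    · simp only [Set.indicator_of_mem hω, norm_mul, Real.norm_eq_abs, abs_of_nonneg hs, abs_abs]
      rw [mul_comm]
      exact mul_le_mul_of_nonneg_left ((h2 hω).trans (le_abs_self _)) (abs_nonneg c)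
    · simp [Set.indicator_of_notMem hω]
  · rw [← hnorm]
    refine eLpNorm_mono_ae ?_
    filter_upwards [hz, h, N.ae_nonneg z] with ω h1 h2 h0
    rw [h1]
    by_cases hω : ω ∈ E
    · simp only [Set.indicator_of_mem hω, norm_mul, Real.norm_eq_abs, abs_of_nonneg hs, abs_abs,
        abs_of_nonneg h0]
      rw [mul_comm]
      exact mul_le_mul_of_nonneg_right (h2 hω) (abs_nonneg c)
    · simp [Set.indicator_of_notMem hω]

/-- A vector of the random unit sphere has random norm `1` wherever its random norm is positive. -/
theorem ae_eq_one_of_mem_unitSphere {x : S} (hx : x ∈ N.unitSphere) :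
    ∀ᵐ ω ∂P, 0 < N x ω → N x ω = 1 := by
  obtain ⟨A, -, -, hA⟩ := hx
  filter_upwards [hA] with ω h h0
  by_cases hω : ω ∈ A
  · rw [h, Set.indicator_of_mem hω]
  · rw [h, Set.indicator_of_notMem hω] at h0
    exact absurd h0 (lt_irrefl 0)

theorem isRandomUniformlyConvex_of_uniformConvexSpace [IsFiniteMeasure P]
    {p : ℝ≥0∞} [hp : Fact (1 ≤ p)] (hp_top : p ≠ ∞) (h : UniformConvexSpace (N.lpSpace p)) :
    N.IsRandomUniformlyConvex := by
  have hp0 : p ≠ 0 := (zero_lt_one.trans_le hp.out).ne'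
  intro ε hε _
  obtain ⟨δ₀, hδ₀, H⟩ := h.uniform_convex hε
  have hδ1 : min (δ₀ / 4) (1 / 2) ≤ δ₀ / 4 := min_le_left _ _
  have hδ2 : min (δ₀ / 4) (1 / 2) ≤ 1 / 2 := min_le_right _ _
  have hδpos : 0 < min (δ₀ / 4) (1 / 2) := lt_min (by linarith) (by norm_num)
  refine ⟨min (δ₀ / 4) (1 / 2), hδpos, by linarith, ?_⟩
  intro x hx y hy D hD _ hB hεD
  set δ := min (δ₀ / 4) (1 / 2) with hδ
  -- `E` is the event on which the desired bound fails.
  set E : Set Ω := D ∩ {ω | 2 * (1 - δ) < N (x + y) ω} with hEdef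
  have hE : MeasurableSet E :=
    hD.inter (measurableSet_lt measurable_const (N (x + y)).measurable)
  rcases eq_or_ne (P E) 0 with hPE | hPE
  · filter_upwards [measure_eq_zero_iff_ae_notMem.1 hPE] with ω hω hωD
    by_contra hlt
    exact hω ⟨hωD, not_le.1 hlt⟩
  exfalso
  have hf : AEStronglyMeasurable (E.indicator fun _ => P.real E ^ (-p.toReal⁻¹)) P :=
    aestronglyMeasurable_const.indicator hE
  have key := fun z s hs => eLpNorm_ofReal_indicator_smul hp0 hp_top N hE hPE hf z (s := s) hs
  have hone : ∀ z ∈ N.unitSphere, (∀ᵐ ω ∂P, ω ∈ D → 0 < N z ω) →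
      eLpNorm (N (L0.ofReal 𝕜 _ hf • z)) p P = 1 := by
    intro z hz hpos
    have h1 : ∀ᵐ ω ∂P, ω ∈ E → N z ω = 1 := by
      filter_upwards [ae_eq_one_of_mem_unitSphere hz, hpos] with ω h1 h2 hω
      exact h1 (h2 hω.1)
    rw [← ENNReal.ofReal_one]
    exact le_antisymm ((key z 1 zero_le_one).2 (h1.mono fun ω h hω => (h hω).le))
      ((key z 1 zero_le_one).1 (h1.mono fun ω h hω => (h hω).ge))
  have hx1 := hone x hx (hB.mono fun ω h hω => (h hω).1)
  have hy1 := hone y hy (hB.mono fun ω h hω => (h hω).2.1)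
  let x' : N.lpSpace p := ⟨L0.ofReal 𝕜 _ hf • x, hx1.trans_lt ENNReal.one_lt_top⟩
  let y' : N.lpSpace p := ⟨L0.ofReal 𝕜 _ hf • y, hy1.trans_lt ENNReal.one_lt_top⟩
  have hx' : ‖x'‖ = 1 := by rw [N.norm_def, hx1, ENNReal.toReal_one]
  have hy' : ‖y'‖ = 1 := by rw [N.norm_def, hy1, ENNReal.toReal_one]
  have hsub : ε ≤ ‖x' - y'‖ := by
    rw [← ENNReal.ofReal_le_ofReal_iff (norm_nonneg _), N.ofReal_norm_lpSpace, Submodule.coe_sub,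
      ← smul_sub]
    exact (key _ ε hε.le).1 (hεD.mono fun ω h hω => h hω.1)
  have hadd : 2 * (1 - δ) ≤ ‖x' + y'‖ := by
    rw [← ENNReal.ofReal_le_ofReal_iff (norm_nonneg _), N.ofReal_norm_lpSpace, Submodule.coe_add,
      ← smul_add]
    exact (key _ _ (by linarith)).1 (.of_forall fun ω hω => hω.2.le)
  linarith [H hx' hy' hsub]

end RandomNorm

theorem theorem1p3 {Ω : Type*} [MeasurableSpace Ω] (P : Measure Ω) [IsProbabilityMeasure P]
    {𝕜 : Type*} [RCLike 𝕜] {S : Type*} [AddCommGroup S] [Module 𝕜 S]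
    [Module (Ω →ₘ[P] 𝕜) S] [IsScalarTower 𝕜 (Ω →ₘ[P] 𝕜) S]
    (N : RandomNorm P 𝕜 S) (hN : N.IsComplete)
    (p : ℝ≥0∞) [Fact (1 ≤ p)] (hp : 1 < p) (hp_top : p < ∞) :
    CompleteSpace (N.lpSpace p) ∧
      (N.IsRandomUniformlyConvex ↔ UniformConvexSpace (N.lpSpace p)) :=
  ⟨N.completeSpace_lpSpace hN p, fun h => h.uniformConvexSpace hp hp_top.ne,
    RandomNorm.isRandomUniformlyConvex_of_uniformConvexSpace hp_top.ne⟩
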